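/- Let $G$ be a discrete group that is commutative-transitive, i.e. every element of $G\setminus\{1\}$ has an abelian centralizer. Let $\ell^1(G)$ be its complex convolution algebra, let $\varepsilon:\ell^1(G)\to\mathbb{C}$, $\varepsilon(f)=\sum_{x\in G}f(x)$, be the augmentation character, and let $I_0(G)=\ker\varepsilon$ be the augmentation ideal, regarded as a Banach $\ell^1(G)$-bimodule by multiplication. For a Banach algebra $A$ and a Banach $A$-bimodule $M$, let $C^n(A,M)$ be the Banach space of bounded $n$-linear maps from $A$ to $M$, and let $d:C^n(A,M)\to C^{n+1}(A,M)$ be the Hochschild coboundary $$(d\psi)(a_1,\dots,a_{n+1})=a_1\cdot\psi(a_2,\dots,a_{n+1})+\sum_{j=1}^n(-1)^j\psi(a_1,\dots,a_ja_{j+1},\dots,a_{n+1})+(-1)^{n+1}\psi(a_1,\dots,a_n)\cdot a_{n+1}.$$ Let $H^n(A,M)$ be the $n$th cohomology group (cocycles modulo coboundaries) of this complex, with the quotient topology. Duals $M'$ carry the bimodule structure $(a\cdot\phi)(m)=\phi(m\cdot a)$, $(\phi\cdot a)(m)=\phi(a\cdot m)$, and $\mathbb{C}_\varepsilon$ is $\mathbb{C}$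 with $a\cdot z=z\cdot a=\varepsilon(a)z$. Then: 1. $H^n(\ell^1(G),I_0(G)')=0$ for every $n\ge 1$. 2. Equivalently, for every $n\ge 1$, the canonical map $H^n(\ell^1(G),\mathbb{C}_\varepsilon)\to H^n(\ell^1(G),\ell^1(G)')$ from the bounded cohomology of $G$ to the simplicial cohomology of $\ell^1(G)$, induced by the bimodule map $\mathbb{C}_\varepsilon\to\ell^1(G)'$, $1\mapsto\varepsilon$, is a topological isomorphism (a linear bijection that is a homeomorphism). -/

import Mathlib

open scoped lp

noncomputable section

/-! ### Hochschild cohomology of Banach algebras -/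

section Hochschild

/-- A bimodule structure over a Banach algebra `A` on a Banach space `M`: two jointly continuous
bilinear actions `left a m = a · m` and `right a m = m · a` which are associative and commute.
Completeness of `A` and `M` plays no role in the definitions and is not part of the structure. -/
structure BanachBimodule (A : Type*) [NormedRing A] [NormedAlgebra ℂ A]
    (M : Type*) [NormedAddCommGroup M] [NormedSpace ℂ M] where
  /-- `left a m` is `a · m`. -/
  left : A →L[ℂ] M →L[ℂ] M
  /-- `right a m` is `m · a`. -/
  right : A →L[ℂ] M →L[ℂ] M
  left_mul : ∀ a b m, left (a * b) m = left a (left b m)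
  right_mul : ∀ a b m, right (a * b) m = right b (right a m)
  right_left : ∀ a b m, right b (left a m) = left a (right b m)

variable {A : Type*} [NormedRing A] [NormedAlgebra ℂ A]
  {M : Type*} [NormedAddCommGroup M] [NormedSpace ℂ M]
  {N : Type*} [NormedAddCommGroup N] [NormedSpace ℂ N]

namespace BanachBimodule

/-- The dual bimodule `M'`: `(a · φ)(m) = φ(m · a)` and `(φ · a)(m) = φ(a · m)`. -/
def dual (X : BanachBimodule A M) : BanachBimodule A (M →L[ℂ] ℂ) where
  left := (ContinuousLinearMap.compL ℂ M M ℂ).flip.comp X.right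
  right := (ContinuousLinearMap.compL ℂ M M ℂ).flip.comp X.left
  left_mul a b φ := by ext m; simp [X.right_mul]
  right_mul a b φ := by ext m; simp [X.left_mul]
  right_left a b φ := by ext m; simp [X.right_left]

theorem dual_left_apply (X : BanachBimodule A M) (a : A) (φ : M →L[ℂ] ℂ) (m : M) :
    X.dual.left a φ m = φ (X.right a m) := rfl

theorem dual_right_apply (X : BanachBimodule A M) (a : A) (φ : M →L[ℂ] ℂ) (m : M) :
    X.dual.right a φ m = φ (X.left a m) := rfl

variable (A) in
/-- `A` as a bimodule over itself, by multiplication. -/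
def regular : BanachBimodule A A where
  left := ContinuousLinearMap.mul ℂ A
  right := (ContinuousLinearMap.mul ℂ A).flip
  left_mul a b m := by simp [mul_assoc]
  right_mul a b m := by simp [mul_assoc]
  right_left a b m := by simp [mul_assoc]

/-- A two-sided ideal `J` of `A` as an `A`-bimodule, by multiplication. -/
def ofIdeal (J : Submodule ℂ A) (hl : ∀ a, ∀ m ∈ J, a * m ∈ J) (hr : ∀ a, ∀ m ∈ J, m * a ∈ J) :
    BanachBimodule A J where
  left := LinearMap.mkContinuous₂
    (LinearMap.mk₂ ℂ (fun (a : A) (m : J) => (⟨a * m, hl a m m.2⟩ : J))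
      (fun _ _ _ => by ext; simp [add_mul]) (fun _ _ _ => by ext; simp)
      (fun _ _ _ => by ext; simp [mul_add]) (fun _ _ _ => by ext; simp))
    1 (fun a m => by simpa using norm_mul_le a (m : A))
  right := LinearMap.mkContinuous₂
    (LinearMap.mk₂ ℂ (fun (a : A) (m : J) => (⟨m * a, hr a m m.2⟩ : J))
      (fun _ _ _ => by ext; simp [mul_add]) (fun _ _ _ => by ext; simp)
      (fun _ _ _ => by ext; simp [add_mul]) (fun _ _ _ => by ext; simp))
    1 (fun a m => by simpa [mul_comm] using norm_mul_le (m : A) a)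
  left_mul a b m := by ext; simp [mul_assoc]
  right_mul a b m := by ext; simp [mul_assoc]
  right_left a b m := by ext; simp [mul_assoc]

/-- The one-dimensional bimodule `ℂ_φ` of a character `φ`: `a · z = φ(a) z = z · a`. -/
def ofCharacter (φ : A →L[ℂ] ℂ) (hφ : ∀ a b, φ (a * b) = φ a * φ b) : BanachBimodule A ℂ where
  left := (ContinuousLinearMap.mul ℂ ℂ).comp φ
  right := (ContinuousLinearMap.mul ℂ ℂ).comp φ
  left_mul a b m := by simp [hφ, mul_assoc]
  right_mul a b m := by simp only [ContinuousLinearMap.comp_apply, hφ,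
    ContinuousLinearMap.mul_apply']; ring
  right_left a b m := by simp only [ContinuousLinearMap.comp_apply,
    ContinuousLinearMap.mul_apply']; ring

/-- A bounded linear map which commutes with both actions. -/
structure Hom (X : BanachBimodule A M) (Y : BanachBimodule A N) where
  /-- The underlying bounded linear map. -/
  toCLM : M →L[ℂ] N
  map_left : ∀ a m, toCLM (X.left a m) = Y.left a (toCLM m)
  map_right : ∀ a m, toCLM (X.right a m) = Y.right a (toCLM m)

/-- The map of bimodules `ℂ_φ → A'` which sends `1` to `φ`. -/
def charToDual (φ : A →L[ℂ] ℂ) (hφ : ∀ a b, φ (a * b) = φ a * φ b) :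
    Hom (ofCharacter φ hφ) (regular A).dual where
  toCLM := ContinuousLinearMap.toSpanSingleton ℂ φ
  map_left a z := by
    ext b
    simp only [dual_left_apply, ofCharacter, regular, ContinuousLinearMap.comp_apply,
      ContinuousLinearMap.mul_apply', ContinuousLinearMap.flip_apply,
      ContinuousLinearMap.toSpanSingleton_apply, smul_apply, hφ, smul_eq_mul]
    ring
  map_right a z := by
    ext b
    simp only [dual_right_apply, ofCharacter, regular, ContinuousLinearMap.comp_apply,
      ContinuousLinearMap.mul_apply',
      ContinuousLinearMap.toSpanSingleton_apply, smul_apply, hφ, smul_eq_mul]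
    ring

end BanachBimodule

variable (A M) in
/-- The Banach space of bounded `n`-linear maps from `A` to `M`. -/
abbrev HochCochain (n : ℕ) : Type _ := ContinuousMultilinearMap ℂ (fun _ : Fin n => A) M

theorem contractNth_update_lt {R : Type*} [Mul R] {n : ℕ} (j : Fin n) (a : Fin (n + 1) → R) (k : Fin (n + 1))
    (x : R) (h : k < j.castSucc) :
    Fin.contractNth j.castSucc (· * ·) (Function.update a k x) =
      Function.update (Fin.contractNth j.castSucc (· * ·) a)
        (k.castLT (by have := j.2; simp [Fin.lt_def] at h; omega)) x := by
  funext i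
  simp only [Fin.lt_def, Fin.val_castSucc] at h
  simp only [Fin.contractNth, Function.update_apply, Fin.ext_iff, Fin.val_castSucc, Fin.val_succ,
    Fin.val_castLT]
  split_ifs <;> first | rfl | omega

theorem contractNth_update_left {R : Type*} [Mul R] {n : ℕ} (j : Fin n) (a : Fin (n + 1) → R) (x : R) :
    Fin.contractNth j.castSucc (· * ·) (Function.update a j.castSucc x) =
      Function.update (Fin.contractNth j.castSucc (· * ·) a) j (x * a j.succ) := by
  funext i
  rcases lt_trichotomy i j with h | rfl | h
  · have : (i : ℕ) < j := h
    simp only [Fin.contractNth, Function.update_apply, Fin.ext_iff, Fin.val_castSucc, Fin.val_succ]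
    split_ifs <;> first | rfl | omega
  · simp [Fin.contractNth, Fin.ext_iff]
  · have : (j : ℕ) < i := h
    simp only [Fin.contractNth, Function.update_apply, Fin.ext_iff, Fin.val_castSucc, Fin.val_succ]
    split_ifs <;> first | rfl | omega

theorem contractNth_update_right {R : Type*} [Mul R] {n : ℕ} (j : Fin n) (a : Fin (n + 1) → R) (x : R) :
    Fin.contractNth j.castSucc (· * ·) (Function.update a j.succ x) =
      Function.update (Fin.contractNth j.castSucc (· * ·) a) j (a j.castSucc * x) := by
  funext i
  rcases lt_trichotomy i j with h | rfl | h
  · have : (i : ℕ) < j := h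
    simp only [Fin.contractNth, Function.update_apply, Fin.ext_iff, Fin.val_castSucc, Fin.val_succ]
    split_ifs <;> first | rfl | omega
  · simp [Fin.contractNth, Fin.ext_iff]
  · have : (j : ℕ) < i := h
    simp only [Fin.contractNth, Function.update_apply, Fin.ext_iff, Fin.val_castSucc, Fin.val_succ]
    split_ifs <;> first | rfl | omega

theorem contractNth_update_gt {R : Type*} [Mul R] {n : ℕ} (j : Fin n) (a : Fin (n + 1) → R) (k : Fin (n + 1))
    (x : R) (h : j.succ < k) :
    Fin.contractNth j.castSucc (· * ·) (Function.update a k x) =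
      Function.update (Fin.contractNth j.castSucc (· * ·) a)
        (k.pred (by rintro rfl; simp at h)) x := by
  funext i
  simp only [Fin.lt_def, Fin.val_succ] at h
  simp only [Fin.contractNth, Function.update_apply, Fin.ext_iff, Fin.val_castSucc, Fin.val_succ,
    Fin.val_pred]
  split_ifs <;> first | rfl | omega

/-- The cochain `(a₀, …, aₙ) ↦ ψ(a₀, …, aⱼ aⱼ₊₁, …, aₙ)`. -/
def hochFace {n : ℕ} (j : Fin n) (ψ : HochCochain A M n) : HochCochain A M (n + 1) where
  toFun a := ψ (Fin.contractNth j.castSucc (· * ·) a)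
  map_update_add' {inst} a k x y := by
    rw [Subsingleton.elim inst (instDecidableEqFin (n + 1))]
    rcases lt_trichotomy k j.castSucc with h | rfl | h
    · simp only [contractNth_update_lt _ _ _ _ h, ψ.map_update_add]
    · simp only [contractNth_update_left, add_mul, ψ.map_update_add]
    · rcases (Fin.castSucc_lt_iff_succ_le.1 h).eq_or_lt with rfl | h
      · simp only [contractNth_update_right, mul_add, ψ.map_update_add]
      · simp only [contractNth_update_gt _ _ _ _ h, ψ.map_update_add]
  map_update_smul' {inst} a k c x := by
    rw [Subsingleton.elim inst (instDecidableEqFin (n + 1))]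
    rcases lt_trichotomy k j.castSucc with h | rfl | h
    · simp only [contractNth_update_lt _ _ _ _ h, ψ.map_update_smul]
    · simp only [contractNth_update_left, smul_mul_assoc, ψ.map_update_smul]
    · rcases (Fin.castSucc_lt_iff_succ_le.1 h).eq_or_lt with rfl | h
      · simp only [contractNth_update_right, mul_smul_comm, ψ.map_update_smul]
      · simp only [contractNth_update_gt _ _ _ _ h, ψ.map_update_smul]
  cont := by
    refine ψ.cont.comp (continuous_pi fun i => ?_)
    simp only [Fin.contractNth]
    split_ifs <;> fun_prop

theorem hochFace_apply {n : ℕ} (j : Fin n) (ψ : HochCochain A M n) (a : Fin (n + 1) → A) :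
    hochFace j ψ a = ψ (Fin.contractNth j.castSucc (· * ·) a) := rfl

/-- The cochain `(a₀, …, aₙ) ↦ a₀ · ψ(a₁, …, aₙ)`. -/
def hochFirst (X : BanachBimodule A M) {n : ℕ} (ψ : HochCochain A M n) :
    HochCochain A M (n + 1) :=
  ContinuousLinearMap.uncurryLeft (Ei := fun _ : Fin (n + 1) => A)
    (((ContinuousLinearMap.compContinuousMultilinearMapL ℂ (fun _ : Fin n => A) M M).flip
      ψ).comp X.left)

/-- The cochain `(a₀, …, aₙ) ↦ ψ(a₀, …, aₙ₋₁) · aₙ`. -/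
def hochLast (X : BanachBimodule A M) {n : ℕ} (ψ : HochCochain A M n) :
    HochCochain A M (n + 1) :=
  ContinuousMultilinearMap.uncurryRight (Ei := fun _ : Fin (n + 1) => A)
    (X.right.flip.compContinuousMultilinearMap ψ)

/-- The Hochschild coboundary operator from `n`-cochains to `(n + 1)`-cochains; its value at a
tuple is given by `hochD_apply`. -/
def hochD (X : BanachBimodule A M) (n : ℕ) : HochCochain A M n →ₗ[ℂ] HochCochain A M (n + 1) where
  toFun ψ := hochFirst X ψ + ∑ j : Fin n, (-1 : ℂ) ^ ((j : ℕ) + 1) • hochFace j ψ +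
    (-1 : ℂ) ^ (n + 1) • hochLast X ψ
  map_add' ψ χ := by
    ext a
    simp only [hochFirst, hochFace_apply, hochLast, add_apply,
      sum_apply, smul_apply,
      ContinuousLinearMap.uncurryLeft_apply, ContinuousMultilinearMap.uncurryRight_apply,
      ContinuousLinearMap.comp_apply, ContinuousLinearMap.flip_apply,
      ContinuousLinearMap.compContinuousMultilinearMapL_apply,
      ContinuousLinearMap.compContinuousMultilinearMap_coe, Function.comp_apply, map_add,
      smul_add, Finset.sum_add_distrib]
    abel
  map_smul' c ψ := by
    ext a
    simp only [hochFirst, hochFace_apply, hochLast, add_apply,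
      sum_apply, smul_apply,
      ContinuousLinearMap.uncurryLeft_apply, ContinuousMultilinearMap.uncurryRight_apply,
      ContinuousLinearMap.comp_apply, ContinuousLinearMap.flip_apply,
      ContinuousLinearMap.compContinuousMultilinearMapL_apply,
      ContinuousLinearMap.compContinuousMultilinearMap_coe, Function.comp_apply, map_smul,
      smul_add, Finset.smul_sum, RingHom.id_apply, smul_comm c]

theorem hochD_apply (X : BanachBimodule A M) {n : ℕ} (ψ : HochCochain A M n)
    (a : Fin (n + 1) → A) :
    hochD X n ψ a = X.left (a 0) (ψ (Fin.tail a)) +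
      ∑ j : Fin n, (-1 : ℂ) ^ ((j : ℕ) + 1) • ψ (Fin.contractNth j.castSucc (· * ·) a) +
      (-1 : ℂ) ^ (n + 1) • X.right (a (Fin.last n)) (ψ (Fin.init a)) := by
  simp [hochD, hochFirst, hochFace_apply, hochLast]

/-- The cocycles `Zⁿ(A, M)`. -/
def hochCocycles (X : BanachBimodule A M) (n : ℕ) : Submodule ℂ (HochCochain A M n) :=
  LinearMap.ker (hochD X n)

/-- The coboundaries `Bⁿ(A, M)`; they vanish in degree zero. -/
def hochCoboundaries (X : BanachBimodule A M) : (n : ℕ) → Submodule ℂ (HochCochain A M n)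
  | 0 => ⊥
  | n + 1 => LinearMap.range (hochD X n)

/-- The cohomology group `Hⁿ(A, M) = Zⁿ(A, M) / Bⁿ(A, M)`, with the quotient topology of the
norm topology. -/
abbrev HochCohomology (X : BanachBimodule A M) (n : ℕ) : Type _ :=
  hochCocycles X n ⧸ (hochCoboundaries X n).submoduleOf (hochCocycles X n)

variable {X : BanachBimodule A M} {Y : BanachBimodule A N}

/-- The map of cochains given by composition with a map of bimodules. -/
def hochCochainMap (f : X.Hom Y) (n : ℕ) : HochCochain A M n →ₗ[ℂ] HochCochain A N n :=
  (ContinuousLinearMap.compContinuousMultilinearMapL ℂ (fun _ : Fin n => A) M N f.toCLM).toLinearMap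

theorem hochCochainMap_apply (f : X.Hom Y) (n : ℕ) (ψ : HochCochain A M n) (a : Fin n → A) :
    hochCochainMap f n ψ a = f.toCLM (ψ a) := rfl

theorem hochD_hochCochainMap (f : X.Hom Y) (n : ℕ) (ψ : HochCochain A M n) :
    hochD Y n (hochCochainMap f n ψ) = hochCochainMap f (n + 1) (hochD X n ψ) := by
  ext a
  simp only [hochD_apply, hochCochainMap_apply, map_add, map_sum, map_smul, f.map_left,
    f.map_right]

theorem hochCochainMap_mem_cocycles (f : X.Hom Y) (n : ℕ) (ψ : HochCochain A M n)
    (hψ : ψ ∈ hochCocycles X n) : hochCochainMap f n ψ ∈ hochCocycles Y n := by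
  rw [hochCocycles, LinearMap.mem_ker] at *
  rw [hochD_hochCochainMap, hψ, map_zero]

theorem hochCochainMap_mem_coboundaries (f : X.Hom Y) (n : ℕ) (ψ : HochCochain A M n)
    (hψ : ψ ∈ hochCoboundaries X n) : hochCochainMap f n ψ ∈ hochCoboundaries Y n := by
  cases n with
  | zero =>
    have : ψ = 0 := hψ
    rw [this, map_zero]
    exact Submodule.zero_mem _
  | succ n =>
    obtain ⟨χ, rfl⟩ := hψ
    exact ⟨hochCochainMap f n χ, hochD_hochCochainMap f n χ⟩

/-- The linear map `Hⁿ(A, M) → Hⁿ(A, N)` induced by a map of bimodules `M → N`. -/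
def hochCohomologyMap (f : X.Hom Y) (n : ℕ) : HochCohomology X n →ₗ[ℂ] HochCohomology Y n :=
  Submodule.mapQ _ _
    ((hochCochainMap f n).restrict (hochCochainMap_mem_cocycles f n))
    (fun ψ hψ => hochCochainMap_mem_coboundaries f n ψ hψ)

end Hochschild

/-! ### The convolution algebra of a discrete group -/

section GroupAlgebra

variable {G : Type*} [Group G]

theorem summable_norm_l1 {α : Type*} (f : ℓ¹(α, ℂ)) : Summable fun x => ‖f x‖ := by
  simpa using (lp.memℓp f).summable (by simp)

theorem summable_norm_conv_prod (f g : ℓ¹(G, ℂ)) :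
    Summable fun p : G × G => ‖f p.2 * g (p.2⁻¹ * p.1)‖ := by
  let e : G × G ≃ G × G :=
    { toFun := fun p => (p.2, p.2⁻¹ * p.1)
      invFun := fun q => (q.1 * q.2, q.1)
      left_inv := fun p => by simp
      right_inv := fun q => by simp }
  exact (e.summable_iff (f := fun q : G × G => ‖f q.1 * g q.2‖)).2
    ((summable_norm_l1 f).mul_norm (summable_norm_l1 g))

theorem tsum_norm_conv_prod (f g : ℓ¹(G, ℂ)) :
    ∑' p : G × G, ‖f p.2 * g (p.2⁻¹ * p.1)‖ = ‖f‖ * ‖g‖ := by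
  let e : G × G ≃ G × G :=
    { toFun := fun p => (p.2, p.2⁻¹ * p.1)
      invFun := fun q => (q.1 * q.2, q.1)
      left_inv := fun p => by simp
      right_inv := fun q => by simp }
  have h1 : ∀ h : ℓ¹(G, ℂ), ‖h‖ = ∑' x, ‖h x‖ := fun h => by
    simp [lp.norm_eq_tsum_rpow (p := 1) (by simp) h]
  rw [h1 f, h1 g, tsum_mul_tsum_of_summable_norm (by simpa using summable_norm_l1 f)
    (by simpa using summable_norm_l1 g)]
  simpa [e] using e.tsum_eq (fun q : G × G => ‖f q.1 * g q.2‖)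

theorem summable_norm_conv (f g : ℓ¹(G, ℂ)) (x : G) :
    Summable fun y => ‖f y * g (y⁻¹ * x)‖ :=
  (summable_norm_conv_prod f g).prod_factor x

/-- The convolution `(f * g)(x) = ∑ y, f(y) g(y⁻¹ x)` of two summable functions. -/
def l1Conv (f g : ℓ¹(G, ℂ)) : ℓ¹(G, ℂ) :=
  ⟨fun x => ∑' y, f y * g (y⁻¹ * x), by
    refine memℓp_gen ?_
    simp only [ENNReal.toReal_one, Real.rpow_one]
    exact Summable.of_nonneg_of_le (fun _ => norm_nonneg _)
      (fun x => norm_tsum_le_tsum_norm (summable_norm_conv f g x))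
      (summable_norm_conv_prod f g).prod⟩

theorem l1Conv_apply (f g : ℓ¹(G, ℂ)) (x : G) : l1Conv f g x = ∑' y, f y * g (y⁻¹ * x) := rfl

theorem norm_l1Conv_le (f g : ℓ¹(G, ℂ)) : ‖l1Conv f g‖ ≤ ‖f‖ * ‖g‖ := by
  rw [lp.norm_eq_tsum_rpow (p := 1) (by simp) (l1Conv f g), ← tsum_norm_conv_prod f g,
    (summable_norm_conv_prod f g).tsum_prod]
  simp only [ENNReal.toReal_one, Real.rpow_one, one_div, inv_one]
  refine Summable.tsum_le_tsum
    (fun x => norm_tsum_le_tsum_norm (summable_norm_conv f g x)) (summable_norm_l1 _)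
    (summable_norm_conv_prod f g).prod

variable (G) in
/-- Convolution as a bounded bilinear map. -/
def l1ConvL : ℓ¹(G, ℂ) →L[ℂ] ℓ¹(G, ℂ) →L[ℂ] ℓ¹(G, ℂ) :=
  LinearMap.mkContinuous₂
    (LinearMap.mk₂ ℂ l1Conv
      (fun f f' g => by
        ext x
        simp only [l1Conv_apply, lp.coeFn_add, Pi.add_apply, add_mul]
        exact (summable_norm_conv f g x).of_norm.tsum_add (summable_norm_conv f' g x).of_norm)
      (fun c f g => by
        ext x
        simp only [l1Conv_apply, lp.coeFn_smul, Pi.smul_apply, smul_eq_mul, mul_assoc,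
          tsum_mul_left])
      (fun f g g' => by
        ext x
        simp only [l1Conv_apply, lp.coeFn_add, Pi.add_apply, mul_add]
        exact (summable_norm_conv f g x).of_norm.tsum_add (summable_norm_conv f g' x).of_norm)
      (fun c f g => by
        ext x
        simp only [l1Conv_apply, lp.coeFn_smul, Pi.smul_apply, smul_eq_mul, mul_left_comm _ c,
          tsum_mul_left]))
    1 (fun f g => by simpa using norm_l1Conv_le f g)

theorem l1ConvL_apply (f g : ℓ¹(G, ℂ)) : l1ConvL G f g = l1Conv f g := rfl

open Classical in
/-- The standard basis vector at `x`. -/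
def l1Basis {α : Type*} (x : α) : ℓ¹(α, ℂ) := lp.single 1 x 1

theorem l1_ext {α : Type*} {F : Type*} [AddCommMonoid F] [Module ℂ F] [TopologicalSpace F] [T2Space F]
    {S T : ℓ¹(α, ℂ) →L[ℂ] F} (h : ∀ x, S (l1Basis x) = T (l1Basis x)) : S = T := by
  classical
  refine lp.ext_continuousLinearMap (by simp) fun x => ?_
  ext
  simpa [l1Basis] using h x

theorem l1Basis_conv (x : G) (g : ℓ¹(G, ℂ)) (z : G) : l1Conv (l1Basis x) g z = g (x⁻¹ * z) := by
  classical
  rw [l1Conv_apply, tsum_eq_single x]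
  · simp [l1Basis]
  · intro y hy
    simp [l1Basis, Pi.single_eq_of_ne hy]

theorem l1Basis_conv_l1Basis (x y : G) : l1Conv (l1Basis x) (l1Basis y) = l1Basis (x * y) := by
  classical
  ext z
  rw [l1Basis_conv]
  simp only [l1Basis, lp.coeFn_single, Pi.single_apply, inv_mul_eq_iff_eq_mul]

theorem l1Conv_assoc (f g h : ℓ¹(G, ℂ)) : l1Conv (l1Conv f g) h = l1Conv f (l1Conv g h) := by
  have hx : ∀ (x : G) (g h : ℓ¹(G, ℂ)),
      l1Conv (l1Conv (l1Basis x) g) h = l1Conv (l1Basis x) (l1Conv g h) := by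
    intro x g h
    ext z
    rw [l1Basis_conv, l1Conv_apply, l1Conv_apply, ← (Equiv.mulLeft x).tsum_eq]
    simp [l1Basis_conv, mul_assoc]
  have := l1_ext (S := ((l1ConvL G).flip h).comp ((l1ConvL G).flip g))
    (T := (l1ConvL G).flip (l1Conv g h)) (fun x => by simpa [l1ConvL_apply] using hx x g h)
  simpa [l1ConvL_apply] using DFunLike.congr_fun this f

theorem l1Basis_one_conv (f : ℓ¹(G, ℂ)) : l1Conv (l1Basis 1) f = f := by
  ext x
  simp [l1Basis_conv]

theorem l1Conv_l1Basis_one (f : ℓ¹(G, ℂ)) : l1Conv f (l1Basis 1) = f := by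
  have := l1_ext (S := (l1ConvL G).flip (l1Basis 1)) (T := ContinuousLinearMap.id ℂ _)
    (fun x => by simp [l1ConvL_apply, l1Basis_conv_l1Basis])
  simpa [l1ConvL_apply] using DFunLike.congr_fun this f

/-- The Banach algebra structure of `ℓ¹(G)`, with the convolution product. -/
instance : NormedRing ℓ¹(G, ℂ) :=
  { (inferInstance : NormedAddCommGroup ℓ¹(G, ℂ)) with
    mul := l1Conv
    one := l1Basis (1 : G)
    left_distrib := fun f g h => (l1ConvL G f).map_add g h
    right_distrib := fun f g h => ((l1ConvL G).flip h).map_add f g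
    zero_mul := fun f => ((l1ConvL G).flip f).map_zero
    mul_zero := fun f => (l1ConvL G f).map_zero
    mul_assoc := l1Conv_assoc
    one_mul := l1Basis_one_conv
    mul_one := l1Conv_l1Basis_one
    norm_mul_le := norm_l1Conv_le }

instance : NormedAlgebra ℂ ℓ¹(G, ℂ) :=
  { Algebra.ofModule (R := ℂ) (A := ℓ¹(G, ℂ))
      (fun c f g => ((l1ConvL G).flip g).map_smul c f)
      (fun c f g => (l1ConvL G f).map_smul c g) with
    norm_smul_le := fun c f => norm_smul_le c f }

theorem l1_mul_def (f g : ℓ¹(G, ℂ)) : f * g = l1Conv f g := rfl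

theorem l1_mul_apply (f g : ℓ¹(G, ℂ)) (x : G) : (f * g) x = ∑' y, f y * g (y⁻¹ * x) := rfl

theorem l1_one_def : (1 : ℓ¹(G, ℂ)) = l1Basis 1 := rfl

variable (G) in
/-- The augmentation character `ε(f) = ∑ x, f(x)`. -/
def augmentation : ℓ¹(G, ℂ) →L[ℂ] ℂ := lp.tsumCLM ℂ G ℂ

theorem augmentation_apply (f : ℓ¹(G, ℂ)) : augmentation G f = ∑' x, f x := rfl

theorem augmentation_l1Basis (x : G) : augmentation G (l1Basis x) = 1 := by
  classical
  rw [augmentation_apply, tsum_eq_single x]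
  · simp [l1Basis]
  · intro y hy
    simp [l1Basis, Pi.single_eq_of_ne hy]

theorem augmentation_mul (f g : ℓ¹(G, ℂ)) :
    augmentation G (f * g) = augmentation G f * augmentation G g := by
  have hx : ∀ (x : G) (g : ℓ¹(G, ℂ)),
      augmentation G (l1Conv (l1Basis x) g) = augmentation G g := fun x g => by
    rw [augmentation_apply, augmentation_apply, ← (Equiv.mulLeft x).tsum_eq]
    simp [l1Basis_conv]
  have := l1_ext (S := (augmentation G).comp ((l1ConvL G).flip g))
    (T := (augmentation G g) • augmentation G) (fun x => by
      simp [l1ConvL_apply, hx, augmentation_l1Basis])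
  have h3 : augmentation G (f * g) = augmentation G g * augmentation G f :=
    DFunLike.congr_fun this f
  rw [h3, mul_comm]

variable (G) in
/-- The augmentation ideal `I₀(G)`, the kernel of the augmentation character. -/
def augIdeal : Submodule ℂ ℓ¹(G, ℂ) := LinearMap.ker (augmentation G).toLinearMap

theorem mem_augIdeal {f : ℓ¹(G, ℂ)} : f ∈ augIdeal G ↔ augmentation G f = 0 := Iff.rfl

variable (G) in
/-- The augmentation ideal as an `ℓ¹(G)`-bimodule. -/
def augIdealBimodule : BanachBimodule ℓ¹(G, ℂ) (augIdeal G) :=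
  .ofIdeal (augIdeal G)
    (fun a m hm => by rw [mem_augIdeal] at *; rw [augmentation_mul, hm, mul_zero])
    (fun a m hm => by rw [mem_augIdeal] at *; rw [augmentation_mul, hm, zero_mul])

variable (G) in
/-- The one-dimensional bimodule `ℂ_ε`. -/
def augBimodule : BanachBimodule ℓ¹(G, ℂ) ℂ := .ofCharacter (augmentation G) augmentation_mul

variable (G) in
/-- The bounded cohomology `Hⁿ(ℓ¹(G), ℂ_ε)` of `G`. -/
abbrev BoundedCohomology (n : ℕ) : Type _ := HochCohomology (augBimodule G) n

variable (G) in
/-- The simplicial cohomology `Hⁿ(ℓ¹(G), ℓ¹(G)')` of `ℓ¹(G)`. -/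
abbrev SimplicialCohomology (n : ℕ) : Type _ :=
  HochCohomology (BanachBimodule.regular ℓ¹(G, ℂ)).dual n

variable (G) in
/-- The canonical map from the bounded cohomology of `G` to the simplicial cohomology of `ℓ¹(G)`,
induced by the map of bimodules `ℂ_ε → ℓ¹(G)'` which sends `1` to `ε`. -/
def boundedToSimplicial (n : ℕ) : BoundedCohomology G n →ₗ[ℂ] SimplicialCohomology G n :=
  hochCohomologyMap (BanachBimodule.charToDual (augmentation G) augmentation_mul) n

/-- Every element other than the identity has an abelian centralizer. -/
def IsCommutativeTransitive (G : Type*) [Group G] : Prop :=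
  ∀ x : G, x ≠ 1 → ∀ a ∈ Subgroup.centralizer {x}, ∀ b ∈ Subgroup.centralizer {x}, a * b = b * a

end GroupAlgebra

end

/-!
The proof passes from Hochschild cochains on `ℓ¹(G)` to bounded functions on tuples of group
elements (`cochain_ext`, `exists_cochain`). Multiplying the value at `(g₁, …, gₙ)` on the right by
`(g₁ ⋯ gₙ)⁻¹` turns the Hochschild complex with values in a bimodule into the complex of bounded
group cochains with values in the same space, on which `G` acts by conjugation.

For the conjugation action, `δ_1` is an invariant complement of the augmentation ideal `I₀(G)`, and
`I₀(G)'` is the space of bounded functions on `G \ {1}`, through the values at `δ_s - δ_1`. The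
stabilizers of the points of `G \ {1}` are the centralizers, which are commutative by hypothesis,
hence amenable (`exists_invariant_mean`). Transporting invariant means along the conjugacy classes
gives means `m_s` on `G` which are equivariant in `s` (`exists_equivariant_means`). Averaging
pointwise against the `m_s` is an equivariant operator from the bounded functions `G → I₀(G)'` to
`I₀(G)'` which fixes the constants (`exists_average`), and it gives the usual contracting homotopy
in positive degrees (`exists_hochD_eq_of_average`).

For the comparison map `ι` induced by `ℂ_ε → ℓ¹(G)'`, evaluation of twisted cochains at the invariant
vector `δ_1` is a bounded cochain map `σ` with `σ ι = id` (`exists_twist`, `twist_hochD`). It is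
compatible with the bimodule structures only after the twist, but this is enough: `σ` induces a
continuous left inverse of `ι` in cohomology. A cocycle `ψ` with values in `ℓ¹(G)'` restricts to
a coboundary with values in `I₀(G)'`, so up to a coboundary it takes values in `ℂ ε`, and `ι σ`
is the identity in cohomology (`exists_hochCohomology_equiv_of_retraction`). No open mapping theorem
is needed.
-/

noncomputable section

/-! ### Bounded functions on a basis of `ℓ¹` -/

section L1

variable {α : Type*} {F : Type*} [NormedAddCommGroup F] [NormedSpace ℂ F]

theorem norm_l1_eq_tsum (f : ℓ¹(α, ℂ)) : ‖f‖ = ∑' x, ‖f x‖ := by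
  simp [lp.norm_eq_tsum_rpow (p := 1) (by simp) f]

theorem norm_l1Basis (x : α) : ‖(l1Basis x : ℓ¹(α, ℂ))‖ = 1 := by
  classical
  simp [l1Basis, lp.norm_single]

/-- The bounded linear map `f ↦ ∑ x, f(x) u(x)` on `ℓ¹` with prescribed bounded values `u` on the
standard basis. -/
def l1Lift [CompleteSpace F] (u : α → F) (C : ℝ) (hu : ∀ x, ‖u x‖ ≤ C) : ℓ¹(α, ℂ) →L[ℂ] F :=
  have hs : ∀ f : ℓ¹(α, ℂ), Summable fun x => ‖f x • u x‖ := fun f =>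
    Summable.of_nonneg_of_le (fun _ => norm_nonneg _)
      (fun x => (norm_smul_le _ _).trans (mul_le_mul_of_nonneg_left (hu x) (norm_nonneg _)))
      ((summable_norm_l1 f).mul_right C)
  LinearMap.mkContinuous
    { toFun := fun f => ∑' x, f x • u x
      map_add' := fun f g => by
        simp only [lp.coeFn_add, Pi.add_apply, add_smul]
        exact (hs f).of_norm.tsum_add (hs g).of_norm
      map_smul' := fun c f => by
        simp only [lp.coeFn_smul, Pi.smul_apply, smul_assoc, RingHom.id_apply]
        exact (hs f).of_norm.tsum_const_smul c }
    C fun f => by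
      refine (norm_tsum_le_tsum_norm (hs f)).trans ?_
      rw [norm_l1_eq_tsum, mul_comm, ← tsum_mul_right]
      exact (hs f).tsum_le_tsum
        (fun x => (norm_smul_le _ _).trans (mul_le_mul_of_nonneg_left (hu x) (norm_nonneg _)))
        ((summable_norm_l1 f).mul_right C)

theorem l1Lift_l1Basis [CompleteSpace F] (u : α → F) (C : ℝ) (hu : ∀ x, ‖u x‖ ≤ C) (x : α) :
    l1Lift u C hu (l1Basis x) = u x := by
  classical
  change ∑' y, (l1Basis x : ℓ¹(α, ℂ)) y • u y = u x
  rw [tsum_eq_single x]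
  · simp [l1Basis]
  · intro y hy
    simp [l1Basis, Pi.single_eq_of_ne hy]

theorem norm_l1Lift_le [CompleteSpace F] (u : α → F) (C : ℝ) (hC : 0 ≤ C) (hu : ∀ x, ‖u x‖ ≤ C) :
    ‖l1Lift u C hu‖ ≤ C := by
  unfold l1Lift
  exact LinearMap.mkContinuous_norm_le _ hC _

/-- Cochains are determined by their values on tuples of basis vectors. -/
theorem cochain_ext {G : Type*} [Group G] {F : Type*} [NormedAddCommGroup F] [NormedSpace ℂ F]
    {n : ℕ} {ψ χ : HochCochain ℓ¹(G, ℂ) F n}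
    (h : ∀ g : Fin n → G, ψ (fun i => l1Basis (g i)) = χ (fun i => l1Basis (g i))) : ψ = χ := by
  induction n generalizing F with
  | zero =>
    ext a
    have := h Fin.elim0
    rwa [Subsingleton.elim (fun i : Fin 0 => (l1Basis (Fin.elim0 i : G) : ℓ¹(G, ℂ))) a] at this
  | succ n ih =>
    have key : ψ.curryLeft = χ.curryLeft := by
      refine l1_ext fun x => ?_
      refine ih fun g => ?_
      have := h (Fin.cons x g)
      have hc : (fun i => l1Basis ((Fin.cons x g : Fin (n + 1) → G) i) : Fin (n + 1) → ℓ¹(G, ℂ)) =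
          Fin.cons (l1Basis x) (fun i => l1Basis (g i)) := by
        funext i
        refine Fin.cases ?_ (fun j => ?_) i <;> simp
      rwa [hc] at this
    rw [← ContinuousMultilinearMap.uncurry_curryLeft ψ, key,
      ContinuousMultilinearMap.uncurry_curryLeft]

/-- Bounded functions on `Gⁿ` extend to bounded `n`-linear maps on `ℓ¹(G)`. -/
theorem exists_cochain {G : Type*} [Group G] {F : Type*} [NormedAddCommGroup F] [NormedSpace ℂ F]
    [CompleteSpace F] {n : ℕ} (u : (Fin n → G) → F) {C : ℝ} (hC : 0 ≤ C) (hu : ∀ g, ‖u g‖ ≤ C) :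
    ∃ ψ : HochCochain ℓ¹(G, ℂ) F n, ‖ψ‖ ≤ C ∧ ∀ g, ψ (fun i => l1Basis (g i)) = u g := by
  induction n with
  | zero =>
    refine ⟨ContinuousMultilinearMap.constOfIsEmpty ℂ _ (u Fin.elim0), ?_, fun g => ?_⟩
    · simpa using hu Fin.elim0
    · simp [Subsingleton.elim g Fin.elim0]
  | succ n ih =>
    choose Ψ hΨ1 hΨ2 using fun x => ih (fun g => u (Fin.cons x g)) (fun g => hu _)
    refine ⟨(l1Lift Ψ C hΨ1).uncurryLeft (Ei := fun _ : Fin (n + 1) => ℓ¹(G, ℂ)), ?_, fun g => ?_⟩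
    · exact (ContinuousLinearMap.uncurryLeft_norm
        (Ei := fun _ : Fin (n + 1) => ℓ¹(G, ℂ)) _).trans_le (norm_l1Lift_le _ _ hC _)
    · rw [ContinuousLinearMap.uncurryLeft_apply, l1Lift_l1Basis]
      have := hΨ2 (g 0) (Fin.tail g)
      rw [Fin.cons_self_tail] at this
      exact this

end L1

/-! ### Invariant means -/

section Means

variable {G : Type*} [Group G]

theorem l1Basis_mul_l1Basis (x y : G) :
    (l1Basis x * l1Basis y : ℓ¹(G, ℂ)) = l1Basis (x * y) :=
  l1Basis_conv_l1Basis x y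

theorem l1Basis_pow (x : G) (n : ℕ) : (l1Basis x : ℓ¹(G, ℂ)) ^ n = l1Basis (x ^ n) := by
  induction n with
  | zero => rw [pow_zero, pow_zero, l1_one_def]
  | succ n ih => rw [pow_succ, pow_succ, ih, l1Basis_mul_l1Basis]

/-- The averages `(1 / N) ∑ i < N, δ_{hⁱ}` are almost invariant under `h`; since the subgroup is
commutative, their products over `h` in a finite set are almost invariant under the whole set. -/
theorem exists_almost_invariant (S : Subgroup G) (hS : ∀ a ∈ S, ∀ b ∈ S, a * b = b * a)
    (F : Finset S) {N : ℕ} (hN : 0 < N) :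
    ∃ a : ℓ¹(G, ℂ), ‖a‖ ≤ 1 ∧ augmentation G a = 1 ∧
      ∀ h ∈ F, ‖l1Basis (h : G) * a - a‖ ≤ 2 / N := by
  classical
  have hN' : (N : ℂ) ≠ 0 := by exact_mod_cast hN.ne'
  have hNr : (0 : ℝ) < N := by exact_mod_cast hN
  induction F using Finset.induction_on with
  | empty =>
    exact ⟨l1Basis 1, (norm_l1Basis 1).le, augmentation_l1Basis 1, by simp⟩
  | insert k F _ ih =>
    obtain ⟨a, ha, ha1, haF⟩ := ih
    set b : ℓ¹(G, ℂ) := (N : ℂ)⁻¹ • ∑ i ∈ Finset.range N, l1Basis (k : G) ^ i with hb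
    have hbn : ‖b‖ ≤ 1 := by
      have h1 : ‖∑ i ∈ Finset.range N, (l1Basis (k : G) : ℓ¹(G, ℂ)) ^ i‖ ≤ N := by
        refine (norm_sum_le _ _).trans ?_
        simp only [l1Basis_pow, norm_l1Basis]
        simp
      rw [hb, norm_smul, norm_inv, Complex.norm_natCast]
      exact inv_mul_le_one_of_le₀ h1 hNr.le
    have hb1 : augmentation G b = 1 := by
      rw [hb, map_smul, map_sum]
      simp only [l1Basis_pow, augmentation_l1Basis]
      simp [hN']
    refine ⟨b * a, ?_, ?_, fun h hh => ?_⟩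
    · exact (norm_mul_le _ _).trans (mul_le_one₀ hbn (norm_nonneg _) ha)
    · rw [augmentation_mul, hb1, ha1, mul_one]
    · rcases Finset.mem_insert.1 hh with rfl | hh
      · have h1 : l1Basis (h : G) * b - b =
            (N : ℂ)⁻¹ • ((l1Basis ((h : G) ^ N) : ℓ¹(G, ℂ)) - l1Basis 1) := by
          rw [hb, mul_smul_comm, ← smul_sub, ← l1Basis_pow, ← l1_one_def, ← mul_geom_sum, sub_mul,
            one_mul]
        have h2 : ‖l1Basis (h : G) * b - b‖ ≤ 2 / N := by
          rw [h1, norm_smul, norm_inv, Complex.norm_natCast, div_eq_inv_mul]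
          gcongr
          refine (norm_sub_le _ _).trans ?_
          rw [norm_l1Basis, norm_l1Basis]
          norm_num
        rw [← mul_assoc, ← sub_mul]
        exact (norm_mul_le _ _).trans
          ((mul_le_of_le_one_right (norm_nonneg _) ha).trans h2)
      · have hc : (l1Basis (h : G) : ℓ¹(G, ℂ)) * b = b * l1Basis (h : G) := by
          rw [hb, mul_smul_comm, smul_mul_assoc, Finset.mul_sum, Finset.sum_mul]
          congr 1
          refine Finset.sum_congr rfl fun i _ => ?_
          rw [l1Basis_pow, l1Basis_mul_l1Basis, l1Basis_mul_l1Basis,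
            hS _ h.2 _ (pow_mem k.2 i)]
        rw [← mul_assoc, hc, mul_assoc, ← mul_sub]
        exact (norm_mul_le _ _).trans
          ((mul_le_of_le_one_left (norm_nonneg _) hbn).trans (haF h hh))

/-- Left translation `L_g` of functionals: `φ ↦ φ(δ_g ·)`. -/
def l1Translate (g : G) (φ : ℓ¹(G, ℂ) →L[ℂ] ℂ) : ℓ¹(G, ℂ) →L[ℂ] ℂ :=
  φ.comp (ContinuousLinearMap.mul ℂ ℓ¹(G, ℂ) (l1Basis g))

theorem l1Translate_apply (g : G) (φ : ℓ¹(G, ℂ) →L[ℂ] ℂ) (a : ℓ¹(G, ℂ)) :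
    l1Translate g φ a = φ (l1Basis g * a) := rfl

theorem l1Translate_l1Translate (g h : G) (φ : ℓ¹(G, ℂ) →L[ℂ] ℂ) :
    l1Translate h (l1Translate g φ) = l1Translate (g * h) φ := by
  ext a
  simp only [l1Translate_apply, ← mul_assoc, l1Basis_mul_l1Basis]

theorem l1Translate_augmentation (g : G) :
    l1Translate g (augmentation G) = augmentation G := by
  ext a
  rw [l1Translate_apply, augmentation_mul, augmentation_l1Basis, one_mul]

/-- Commutative groups are amenable, in the form needed for a commutative subgroup `S` of `G`:
there is a mean on the bounded functions on `G`, that is, on the dual of `ℓ¹(G)`, which is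
invariant under `S`. -/
theorem exists_invariant_mean (S : Subgroup G) (hS : ∀ a ∈ S, ∀ b ∈ S, a * b = b * a) :
    ∃ μ : (ℓ¹(G, ℂ) →L[ℂ] ℂ) →L[ℂ] ℂ, ‖μ‖ ≤ 1 ∧ μ (augmentation G) = 1 ∧
      ∀ h ∈ S, ∀ φ, μ (l1Translate h φ) = μ φ := by
  classical
  choose a ha ha1 haF using fun i : Finset S × ℕ =>
    exists_almost_invariant S hS i.1 (Nat.succ_pos i.2)
  let ev : ℓ¹(G, ℂ) → WeakDual ℂ (ℓ¹(G, ℂ) →L[ℂ] ℂ) := fun b =>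
    StrongDual.toWeakDual (ContinuousLinearMap.apply ℂ ℂ b)
  have ev_apply : ∀ b φ, ev b φ = φ b := fun b φ => rfl
  let U : Ultrafilter (WeakDual ℂ (ℓ¹(G, ℂ) →L[ℂ] ℂ)) :=
    (Ultrafilter.of (Filter.atTop : Filter (Finset S × ℕ))).map (fun i => ev (a i))
  -- a weak-* limit, along an ultrafilter, of the almost invariant vectors in the bidual of `ℓ¹(G)`
  obtain ⟨μ, hμ, hU⟩ := (WeakDual.isCompact_closedBall (𝕜 := ℂ)
    (0 : StrongDual ℂ (ℓ¹(G, ℂ) →L[ℂ] ℂ)) 1).ultrafilter_le_nhds U (by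
      rw [Filter.le_principal_iff]
      refine Filter.mem_map.2 (Filter.univ_mem' fun i => ?_)
      rw [Set.mem_preimage, Set.mem_preimage, mem_closedBall_zero_iff]
      refine ContinuousLinearMap.opNorm_le_bound _ zero_le_one fun φ => ?_
      change ‖φ (a i)‖ ≤ _
      rw [one_mul]
      exact (φ.le_opNorm _).trans (mul_le_of_le_one_right (norm_nonneg _) (ha i)))
  have htend : ∀ φ, Filter.Tendsto (fun i => φ (a i))
      (Ultrafilter.of (Filter.atTop : Filter (Finset S × ℕ))) (nhds (μ φ)) := fun φ =>
    ((WeakDual.eval_continuous φ).tendsto μ).comp (show Filter.Tendsto (fun i => ev (a i))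
      (Ultrafilter.of (Filter.atTop : Filter (Finset S × ℕ))) (nhds μ) from hU)
  refine ⟨WeakDual.toStrongDual μ, mem_closedBall_zero_iff.1 hμ, ?_, fun h hh φ => ?_⟩
  · refine tendsto_nhds_unique (htend (augmentation G)) ?_
    simp only [ha1]
    exact tendsto_const_nhds
  · have h0 : Filter.Tendsto (fun i => l1Translate h φ (a i) - φ (a i))
        (Ultrafilter.of (Filter.atTop : Filter (Finset S × ℕ))) (nhds 0) := by
      refine Filter.Tendsto.mono_left ?_ (Ultrafilter.of_le _)
      refine squeeze_zero_norm' (a := fun i : Finset S × ℕ => ‖φ‖ * (2 / ((i.2 + 1 : ℕ) : ℝ))) ?_ ?_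
      · filter_upwards [Filter.eventually_ge_atTop ((({⟨h, hh⟩} : Finset S), 0) : Finset S × ℕ)]
          with i hi
        rw [l1Translate_apply, ← map_sub]
        refine (φ.le_opNorm _).trans (mul_le_mul_of_nonneg_left ?_ (norm_nonneg _))
        exact haF i ⟨h, hh⟩ (hi.1 (Finset.mem_singleton_self _))
      · have h2 : Filter.Tendsto (fun n : ℕ => (2 : ℝ) / ((n + 1 : ℕ) : ℝ)) Filter.atTop (nhds 0) :=
          (tendsto_const_div_atTop_nhds_zero_nat 2).comp (Filter.tendsto_add_atTop_nat 1)
        have h3 : Filter.Tendsto (fun i : Finset S × ℕ => i.2) Filter.atTop Filter.atTop := by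
          rw [← Filter.prod_atTop_atTop_eq]
          exact Filter.tendsto_snd
        simpa using (h2.comp h3).const_mul ‖φ‖
    exact sub_eq_zero.1 (tendsto_nhds_unique ((htend (l1Translate h φ)).sub (htend φ)) h0)

/-- Centralizers are the stabilizers of the conjugation action, so invariant means for the
centralizers of representatives of the conjugacy classes can be transported to a family of means
which is equivariant for conjugation. -/
theorem exists_equivariant_means (hG : IsCommutativeTransitive G) :
    ∃ m : G → (ℓ¹(G, ℂ) →L[ℂ] ℂ) →L[ℂ] ℂ, (∀ s, ‖m s‖ ≤ 1) ∧
      (∀ s, s ≠ 1 → m s (augmentation G) = 1) ∧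
      ∀ g s, s ≠ 1 → ∀ φ, m s (l1Translate g φ) = m (g * s * g⁻¹) φ := by
  have hμ : ∀ r : G, ∃ μ : (ℓ¹(G, ℂ) →L[ℂ] ℂ) →L[ℂ] ℂ, ‖μ‖ ≤ 1 ∧ (r ≠ 1 →
      μ (augmentation G) = 1 ∧ ∀ h ∈ Subgroup.centralizer {r}, ∀ φ,
        μ (l1Translate h φ) = μ φ) := fun r => by
    by_cases hr : r = 1
    · exact ⟨0, ContinuousLinearMap.opNorm_zero.trans_le zero_le_one, fun h => absurd hr h⟩
    · obtain ⟨μ, h1, h2⟩ := exists_invariant_mean (Subgroup.centralizer {r}) (hG r hr)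
      exact ⟨μ, h1, fun _ => h2⟩
  choose μ hμ1 hμ2 using hμ
  let r : G → G := fun s => (ConjClasses.mk s).out
  have hr : ∀ s, ∃ c, c * r s * c⁻¹ = s := fun s => by
    have : IsConj (r s) s := ConjClasses.mk_eq_mk_iff_isConj.1 (Quotient.out_eq (ConjClasses.mk s))
    exact isConj_iff.1 this
  choose c hc using hr
  have hr1 : ∀ s, s ≠ 1 → r s ≠ 1 := fun s hs h => hs (by simpa [h] using (hc s).symm)
  have hT : ∀ (g : G) (φ : ℓ¹(G, ℂ) →L[ℂ] ℂ), ‖l1Translate g φ‖ ≤ ‖φ‖ := fun g φ => by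
    refine ContinuousLinearMap.opNorm_le_bound _ (norm_nonneg _) fun a => ?_
    rw [l1Translate_apply]
    refine (φ.le_opNorm _).trans (mul_le_mul_of_nonneg_left ?_ (norm_nonneg _))
    simpa [norm_l1Basis] using norm_mul_le (l1Basis g) a
  let m : G → (ℓ¹(G, ℂ) →L[ℂ] ℂ) →L[ℂ] ℂ := fun s =>
    LinearMap.mkContinuous
      { toFun := fun φ => μ (r s) (l1Translate (c s) φ)
        map_add' := fun φ χ => by rw [← map_add]; rfl
        map_smul' := fun z φ => by rw [RingHom.id_apply, ← map_smul]; rfl } 1 fun φ => by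
      rw [one_mul]
      exact ((μ (r s)).le_opNorm _).trans
        ((mul_le_of_le_one_left (norm_nonneg _) (hμ1 _)).trans (hT _ _))
  have hm : ∀ s φ, m s φ = μ (r s) (l1Translate (c s) φ) := fun s φ => rfl
  refine ⟨m, fun s => LinearMap.mkContinuous_norm_le _ zero_le_one _, fun s hs => ?_,
    fun g s hs φ => ?_⟩
  · rw [hm, l1Translate_augmentation, (hμ2 _ (hr1 s hs)).1]
  · have hrr : r (g * s * g⁻¹) = r s :=
      congrArg Quotient.out (ConjClasses.mk_eq_mk_iff_isConj.2 (isConj_iff.2 ⟨g, rfl⟩)).symm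
    have hcc := hc (g * s * g⁻¹)
    rw [hrr] at hcc
    -- two elements conjugating `r s` to the same element differ by an element of the centralizer
    have hmem : (c (g * s * g⁻¹))⁻¹ * (g * c s) ∈ Subgroup.centralizer {r s} := by
      rw [Subgroup.mem_centralizer_singleton_iff]
      have h1 : g * c s * r s * (g * c s)⁻¹ = g * s * g⁻¹ := by
        conv_rhs => rw [← hc s]
        group
      have h2 : c (g * s * g⁻¹) * r s * (c (g * s * g⁻¹))⁻¹ = g * c s * r s * (g * c s)⁻¹ :=
        hcc.trans h1.symm
      have h3 : r s = (c (g * s * g⁻¹))⁻¹ * (g * c s * r s * (g * c s)⁻¹) * c (g * s * g⁻¹) := by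
        rw [← h2]; group
      conv_rhs => rw [h3]
      group
    rw [hm, hm, hrr, l1Translate_l1Translate,
      ← (hμ2 _ (hr1 s hs)).2 _ hmem (l1Translate (c (g * s * g⁻¹)) φ), l1Translate_l1Translate,
      mul_inv_cancel_left]

end Means

/-! ### Averaging bounded functions with values in the dual of the augmentation ideal -/

section Averaging

variable {G : Type*} [Group G]

/-- The element `δ_s - δ_1` of the augmentation ideal. -/
def augElt (s : G) : augIdeal G :=
  ⟨l1Basis s - l1Basis 1, by
    rw [mem_augIdeal, map_sub, augmentation_l1Basis, augmentation_l1Basis, sub_self]⟩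

theorem augElt_one : augElt (1 : G) = 0 := by
  ext1
  exact sub_self _

theorem norm_augElt_le (s : G) : ‖augElt s‖ ≤ 2 := by
  refine (norm_sub_le (l1Basis s : ℓ¹(G, ℂ)) (l1Basis 1)).trans ?_
  rw [norm_l1Basis, norm_l1Basis]
  norm_num

/-- The bounded operators between two normed spaces. As opposed to the notation `V →L[ℂ] W`, the
algebraic and topological structures are those which come from the norms; for `ℓ¹(G)` and its
augmentation ideal, type class search finds syntactically different ones. -/
abbrev BddMap (V W : Type*) [NormedAddCommGroup V] [NormedSpace ℂ V] [NormedAddCommGroup W]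
    [NormedSpace ℂ W] : Type _ := V →L[ℂ] W

variable (G) in
/-- The projection `f ↦ f - ε(f) δ_1` of `ℓ¹(G)` onto the augmentation ideal. -/
def augProj : BddMap ℓ¹(G, ℂ) (augIdeal G) :=
  (ContinuousLinearMap.id ℂ _ - (augmentation G).smulRight (l1Basis 1)).codRestrict (augIdeal G)
    fun f => by
      rw [mem_augIdeal]
      simp [augmentation_l1Basis]

theorem augProj_l1Basis (s : G) : augProj G (l1Basis s) = augElt s := by
  ext1
  simp [augProj, augElt, augmentation_l1Basis]

theorem augProj_coe (f : augIdeal G) : augProj G f = f := by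
  have := mem_augIdeal.1 f.2
  ext1
  simp [augProj, this]

theorem augIdeal_dual_ext {φ χ : BddMap (augIdeal G) ℂ} (h : ∀ s, φ (augElt s) = χ (augElt s)) :
    φ = χ := by
  have key : φ.comp (augProj G) = χ.comp (augProj G) :=
    l1_ext fun s => by
      rw [ContinuousLinearMap.comp_apply, ContinuousLinearMap.comp_apply, augProj_l1Basis, h]
  ext f
  have := DFunLike.congr_fun key (f : ℓ¹(G, ℂ))
  rwa [ContinuousLinearMap.comp_apply, ContinuousLinearMap.comp_apply, augProj_coe] at this

/-- The dual of the augmentation ideal is, for conjugation, the space of bounded functions on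
`G \ {1}`. -/
theorem augIdeal_dual_conj_apply (g s : G) (φ : BddMap (augIdeal G) ℂ) :
    (augIdealBimodule G).dual.left (l1Basis g)
      ((augIdealBimodule G).dual.right (l1Basis g⁻¹) φ) (augElt s) = φ (augElt (g⁻¹ * s * g)) := by
  rw [BanachBimodule.dual_left_apply, BanachBimodule.dual_right_apply]
  congr 1
  ext1
  change l1Basis g⁻¹ * ((l1Basis s - l1Basis 1) * l1Basis g) = l1Basis (g⁻¹ * s * g) - l1Basis 1
  simp only [sub_mul, mul_sub, l1Basis_mul_l1Basis, one_mul, inv_mul_cancel, mul_assoc]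

theorem norm_eval_le {V W : Type*} [NormedAddCommGroup V] [NormedSpace ℂ V] [NormedAddCommGroup W]
    [NormedSpace ℂ W] (F : BddMap V (BddMap W ℂ)) (w : W) :
    ‖((ContinuousLinearMap.apply ℂ ℂ w).comp F : BddMap V ℂ)‖ ≤ ‖F‖ * ‖w‖ := by
  refine ContinuousLinearMap.opNorm_le_bound _ (by positivity) fun a => ?_
  calc ‖F a w‖ ≤ ‖F a‖ * ‖w‖ := (F a).le_opNorm _
    _ ≤ (‖F‖ * ‖a‖) * ‖w‖ := mul_le_mul_of_nonneg_right (F.le_opNorm a) (norm_nonneg _)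
    _ = ‖F‖ * ‖w‖ * ‖a‖ := by ring

/-- Pointwise averaging: the dual of `V` is identified with the bounded functions on `S` which
vanish at `s₀`, through the values at the vectors `e s`, and an operator-valued function is averaged
at `s` against the mean `m s`. -/
theorem exists_pointwise_average {A V S : Type*} [NormedAddCommGroup A] [NormedSpace ℂ A]
    [NormedAddCommGroup V] [NormedSpace ℂ V] (i : BddMap V ℓ¹(S, ℂ)) (hi : ∀ v, ‖i v‖ ≤ ‖v‖)
    (s₀ : S) (e : S → V) (he : ∀ s, ‖e s‖ ≤ 2) (he₀ : e s₀ = 0)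
    (hie : ∀ s, i (e s) = l1Basis s - l1Basis s₀)
    (hext : ∀ φ χ : BddMap V ℂ, (∀ s, φ (e s) = χ (e s)) → φ = χ)
    (m : S → BddMap (BddMap A ℂ) ℂ) (hm : ∀ s, ‖m s‖ ≤ 1) :
    ∃ T : BddMap A (BddMap V ℂ) →ₗ[ℂ] BddMap V ℂ, (∀ F, ‖T F‖ ≤ 2 * ‖F‖) ∧
      ∀ F s, T F (e s) = m s ((ContinuousLinearMap.apply ℂ ℂ (e s)).comp F) := by
  have hbd : ∀ (F : BddMap A (BddMap V ℂ)) s,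
      ‖m s ((ContinuousLinearMap.apply ℂ ℂ (e s)).comp F)‖ ≤ 2 * ‖F‖ := fun F s => by
    refine ((m s).le_opNorm _).trans ((mul_le_of_le_one_left (norm_nonneg _) (hm s)).trans ?_)
    refine (norm_eval_le F (e s)).trans ?_
    rw [mul_comm]
    exact mul_le_mul_of_nonneg_right (he s) (norm_nonneg _)
  let T₀ : BddMap A (BddMap V ℂ) → BddMap V ℂ := fun F => (l1Lift _ _ (hbd F)).comp i
  have hT₀ : ∀ F s, T₀ F (e s) = m s ((ContinuousLinearMap.apply ℂ ℂ (e s)).comp F) := fun F s => by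
    have h1 : (ContinuousLinearMap.apply ℂ ℂ (e s₀)).comp F = 0 := by
      ext a
      rw [he₀]
      simp
    change l1Lift _ _ (hbd F) (i (e s)) = _
    rw [hie, map_sub, l1Lift_l1Basis, l1Lift_l1Basis, h1, map_zero, sub_zero]
  refine ⟨⟨⟨T₀, fun F F' => ?_⟩, fun c F => ?_⟩, fun F => ?_, hT₀⟩
  · refine hext _ _ fun s => ?_
    rw [add_apply, hT₀, hT₀, hT₀, ← map_add]
    rfl
  · refine hext _ _ fun s => ?_
    rw [smul_apply, hT₀, RingHom.id_apply, hT₀, ← map_smul]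
    rfl
  · change ‖T₀ F‖ ≤ _
    refine ContinuousLinearMap.opNorm_le_bound _ (by positivity) fun f => ?_
    change ‖l1Lift _ _ (hbd F) (i f)‖ ≤ _
    exact (ContinuousLinearMap.le_opNorm _ _).trans
      (mul_le_mul (norm_l1Lift_le _ _ (by positivity) _) (hi f) (norm_nonneg _) (by positivity))

/-- An averaging operator: for a commutative-transitive group `G`, bounded functions from `G` to
the dual of the augmentation ideal, encoded as bounded operators on `ℓ¹(G)`, can be averaged
in a way which fixes constants and is equivariant for the conjugation action. -/
theorem exists_average (hG : IsCommutativeTransitive G) :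
    ∃ T : BddMap ℓ¹(G, ℂ) (BddMap (augIdeal G) ℂ) →ₗ[ℂ] BddMap (augIdeal G) ℂ,
      (∀ F, ‖T F‖ ≤ 2 * ‖F‖) ∧
      (∀ F φ, (∀ x, F (l1Basis x) = φ) → T F = φ) ∧
      ∀ g F F', (∀ x, F' (l1Basis (g * x)) = (augIdealBimodule G).dual.left (l1Basis g)
          ((augIdealBimodule G).dual.right (l1Basis g⁻¹) (F (l1Basis x)))) →
        T F' = (augIdealBimodule G).dual.left (l1Basis g)
          ((augIdealBimodule G).dual.right (l1Basis g⁻¹) (T F)) := by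
  refine (exists_equivariant_means hG).elim fun m ⟨hm1, hm2, hm3⟩ => ?_
  refine (exists_pointwise_average (A := ℓ¹(G, ℂ)) (V := augIdeal G)
    (augIdeal G).subtypeL (fun _ => le_rfl) 1 augElt norm_augElt_le augElt_one (fun _ => rfl)
    (fun _ _ => augIdeal_dual_ext) m hm1).elim fun T ⟨hT1, hT⟩ => ?_
  refine ⟨T, hT1, fun F φ hF => ?_, fun g F F' hF => ?_⟩
  · refine augIdeal_dual_ext fun s => ?_
    by_cases hs : s = 1
    · rw [hs, augElt_one, map_zero, map_zero]
    · have : (ContinuousLinearMap.apply ℂ ℂ (augElt s)).comp F =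
          φ (augElt s) • augmentation G := by
        refine l1_ext fun x => ?_
        rw [smul_apply, augmentation_l1Basis, smul_eq_mul, mul_one, ← hF x]
        rfl
      rw [hT, this, map_smul, hm2 s hs, smul_eq_mul, mul_one]
  · refine augIdeal_dual_ext fun s => ?_
    rw [augIdeal_dual_conj_apply]
    by_cases hs : s = 1
    · rw [hs, mul_one, inv_mul_cancel, augElt_one, map_zero, map_zero]
    · have : (ContinuousLinearMap.apply ℂ ℂ (augElt s)).comp F' =
          l1Translate g⁻¹ ((ContinuousLinearMap.apply ℂ ℂ (augElt (g⁻¹ * s * g))).comp F) := by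
        refine l1_ext fun x => ?_
        rw [l1Translate_apply, l1Basis_mul_l1Basis]
        change F' (l1Basis x) (augElt s) = F (l1Basis (g⁻¹ * x)) (augElt (g⁻¹ * s * g))
        rw [← augIdeal_dual_conj_apply, ← hF, mul_inv_cancel_left]
      rw [hT, hT, this, hm3 _ _ hs, inv_inv]

end Averaging

/-! ### Cochains on tuples of group elements -/

section Tuples

variable {G : Type*} [Group G]

/-- The tuple of basis vectors of `ℓ¹(G)` given by a tuple of group elements. -/
def l1Tuple {n : ℕ} (g : Fin n → G) : Fin n → ℓ¹(G, ℂ) := fun i => l1Basis (g i)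

/-- The product `g₀ g₁ ⋯ gₙ₋₁` of a tuple. -/
def tupleProd {n : ℕ} (g : Fin n → G) : G := Fin.partialProd g (Fin.last n)

theorem tupleProd_succ {n : ℕ} (g : Fin (n + 1) → G) :
    tupleProd g = g 0 * tupleProd (Fin.tail g) := by
  rw [tupleProd, ← Fin.succ_last, Fin.partialProd_succ']
  rfl

theorem tupleProd_succ' {n : ℕ} (g : Fin (n + 1) → G) :
    tupleProd g = tupleProd (Fin.init g) * g (Fin.last n) := by
  rw [tupleProd, ← Fin.succ_last, Fin.partialProd_succ]
  congr 1
  simp only [tupleProd, Fin.partialProd, Fin.val_castSucc, Fin.val_last, List.ofFn_succ']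
  rw [List.take_of_length_le (l := List.ofFn (Fin.init g)) (by simp)]
  simp
  rfl

theorem tupleProd_contractNth {n : ℕ} (j : Fin n) (g : Fin (n + 1) → G) :
    tupleProd (Fin.contractNth j.castSucc (· * ·) g) = tupleProd g := by
  have h := congrFun (Fin.partialProd_contractNth g j.castSucc) (Fin.last n)
  have hj : j.castSucc.succ.succAbove (Fin.last n) = Fin.last (n + 1) := by
    rw [Fin.succAbove_of_le_castSucc _ _ (by simp [Fin.le_def]), Fin.succ_last]
  rwa [Function.comp_apply, hj] at h

theorem contractNth_l1Tuple {n : ℕ} (j : Fin n) (g : Fin (n + 1) → G) :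
    Fin.contractNth j.castSucc (· * ·) (l1Tuple g) =
      l1Tuple (Fin.contractNth j.castSucc (· * ·) g) := by
  funext i
  simp only [Fin.contractNth, l1Tuple]
  split_ifs
  · rfl
  · exact l1Basis_mul_l1Basis _ _
  · rfl

theorem contractNth_zero_cons {n : ℕ} (x : G) (g : Fin (n + 1) → G) :
    Fin.contractNth (0 : Fin (n + 1)).castSucc (· * ·) (Fin.cons x g : Fin (n + 2) → G) =
      Fin.cons (x * g 0) (Fin.tail g) := by
  funext i
  refine Fin.cases ?_ (fun i => ?_) i
  · simp [Fin.contractNth]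
  · simp [Fin.contractNth, Fin.tail]

theorem contractNth_succ_cons {n : ℕ} (j : Fin n) (x : G) (g : Fin (n + 1) → G) :
    Fin.contractNth j.succ.castSucc (· * ·) (Fin.cons x g : Fin (n + 2) → G) =
      Fin.cons x (Fin.contractNth j.castSucc (· * ·) g) := by
  funext i
  refine Fin.cases ?_ (fun i => ?_) i
  · simp [Fin.contractNth]
  · simp [Fin.contractNth]

theorem init_cons {α : Type*} {n : ℕ} (x : α) (g : Fin (n + 1) → α) :
    Fin.init (Fin.cons x g : Fin (n + 2) → α) = Fin.cons x (Fin.init g) := by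
  funext i
  refine Fin.cases ?_ (fun i => ?_) i
  · simp [Fin.init]
  · simp [Fin.init]

variable {E : Type*} [NormedAddCommGroup E] [NormedSpace ℂ E]

theorem hochD_l1Tuple (X : BanachBimodule ℓ¹(G, ℂ) E) {n : ℕ} (ψ : HochCochain ℓ¹(G, ℂ) E n)
    (g : Fin (n + 1) → G) :
    hochD X n ψ (l1Tuple g) = X.left (l1Basis (g 0)) (ψ (l1Tuple (Fin.tail g))) +
      ∑ j : Fin n, (-1 : ℂ) ^ ((j : ℕ) + 1) •
        ψ (l1Tuple (Fin.contractNth j.castSucc (· * ·) g)) +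
      (-1 : ℂ) ^ (n + 1) • X.right (l1Basis (g (Fin.last n))) (ψ (l1Tuple (Fin.init g))) := by
  rw [hochD_apply]
  simp only [contractNth_l1Tuple]
  rfl

theorem norm_apply_l1Tuple_le {n : ℕ} (ψ : HochCochain ℓ¹(G, ℂ) E n) (g : Fin n → G) :
    ‖ψ (l1Tuple g)‖ ≤ ‖ψ‖ := by
  refine (ψ.le_opNorm _).trans ?_
  simp [l1Tuple, norm_l1Basis]

/-- The cocycle identity at `(x, g₀, …, gₙ)`, solved for its first term. -/
theorem cocycle_cons (X : BanachBimodule ℓ¹(G, ℂ) E) {n : ℕ} (ψ : HochCochain ℓ¹(G, ℂ) E (n + 1))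
    (hψ : hochD X (n + 1) ψ = 0) (x : G) (g : Fin (n + 1) → G) :
    X.left (l1Basis x) (ψ (l1Tuple g)) =
      ψ (l1Tuple (Fin.cons (x * g 0) (Fin.tail g))) +
      ∑ j : Fin n, (-1 : ℂ) ^ ((j : ℕ) + 1) •
        ψ (l1Tuple (Fin.cons x (Fin.contractNth j.castSucc (· * ·) g))) +
      (-1 : ℂ) ^ (n + 1) •
        X.right (l1Basis (g (Fin.last n))) (ψ (l1Tuple (Fin.cons x (Fin.init g)))) := by
  have h := hochD_l1Tuple X ψ (Fin.cons x g)
  rw [hψ, zero_apply, Fin.sum_univ_succ, contractNth_zero_cons, init_cons] at h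
  simp only [contractNth_succ_cons, Fin.val_zero, Fin.val_succ, Fin.cons_zero, Fin.tail_cons,
    ← Fin.succ_last, Fin.cons_succ] at h
  simp only [pow_succ _ (_ + 1), mul_neg_one, neg_smul, Finset.sum_neg_distrib] at h
  rw [zero_add, pow_one, neg_smul, one_smul] at h
  rw [← sub_eq_zero]
  refine Eq.trans ?_ h.symm
  abel

end Tuples

/-! ### Vanishing of cohomology from an averaging operator -/

section Vanishing

variable {G : Type*} [Group G] {E : Type*} [NormedAddCommGroup E] [NormedSpace ℂ E]

/-- The contracting homotopy: after the twist by the product `p` of the arguments, a cochain with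
values in `E` is a cochain for the conjugation action, and
`χ(g₀, …, gₙ₋₁) = T (x ↦ x · ψ(x⁻¹, g₀, …, gₙ₋₁) · p⁻¹) · p` has coboundary `ψ`,
by averaging the cocycle identity at `(x⁻¹, g₀, …, gₙ)` over `x`. -/
theorem exists_hochD_eq_of_average [CompleteSpace E] (X : BanachBimodule ℓ¹(G, ℂ) E)
    (hl : ∀ φ, X.left (l1Basis 1) φ = φ) (hr : ∀ φ, X.right (l1Basis 1) φ = φ)
    (T : BddMap ℓ¹(G, ℂ) E →ₗ[ℂ] E) (C : ℝ) (hC : 0 ≤ C) (hT : ∀ F, ‖T F‖ ≤ C * ‖F‖)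
    (hconst : ∀ F φ, (∀ x, F (l1Basis x) = φ) → T F = φ)
    (hequiv : ∀ g F F', (∀ x, F' (l1Basis (g * x)) =
      X.left (l1Basis g) (X.right (l1Basis g⁻¹) (F (l1Basis x)))) →
        T F' = X.left (l1Basis g) (X.right (l1Basis g⁻¹) (T F)))
    (n : ℕ) (ψ : HochCochain ℓ¹(G, ℂ) E (n + 1)) (hψ : hochD X (n + 1) ψ = 0) :
    ∃ χ : HochCochain ℓ¹(G, ℂ) E n, hochD X n χ = ψ := by
  have hLL : ∀ (x y : G) φ, X.left (l1Basis x) (X.left (l1Basis y) φ) =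
      X.left (l1Basis (x * y)) φ := fun x y φ => by rw [← X.left_mul, l1Basis_mul_l1Basis]
  have hRR : ∀ (x y : G) φ, X.right (l1Basis x) (X.right (l1Basis y) φ) =
      X.right (l1Basis (y * x)) φ := fun x y φ => by rw [← X.right_mul, l1Basis_mul_l1Basis]
  have hL : ∀ (x : G) φ, ‖X.left (l1Basis x) φ‖ ≤ ‖X.left‖ * ‖φ‖ := fun x φ => by
    simpa [norm_l1Basis] using X.left.le_opNorm₂ (l1Basis x) φ
  have hR : ∀ (x : G) φ, ‖X.right (l1Basis x) φ‖ ≤ ‖X.right‖ * ‖φ‖ := fun x φ => by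
    simpa [norm_l1Basis] using X.right.le_opNorm₂ (l1Basis x) φ
  have hK : 0 ≤ ‖X.left‖ * (‖X.right‖ * ‖ψ‖) := by positivity
  have hb : ∀ (g : Fin n → G) x, ‖X.left (l1Basis x) (X.right (l1Basis (tupleProd g)⁻¹)
      (ψ (l1Tuple (Fin.cons x⁻¹ g))))‖ ≤ ‖X.left‖ * (‖X.right‖ * ‖ψ‖) := fun g x => by
    refine (hL _ _).trans (mul_le_mul_of_nonneg_left ((hR _ _).trans ?_)
      (ContinuousLinearMap.opNorm_nonneg _))
    exact mul_le_mul_of_nonneg_left (norm_apply_l1Tuple_le ψ _)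
      (ContinuousLinearMap.opNorm_nonneg _)
  have hΦ : ∀ g : Fin n → G, ∃ Φ : BddMap ℓ¹(G, ℂ) E, ‖Φ‖ ≤ ‖X.left‖ * (‖X.right‖ * ‖ψ‖) ∧
      ∀ x, Φ (l1Basis x) = X.left (l1Basis x) (X.right (l1Basis (tupleProd g)⁻¹)
        (ψ (l1Tuple (Fin.cons x⁻¹ g)))) := fun g =>
    ⟨l1Lift _ _ (hb g), norm_l1Lift_le _ _ hK _, l1Lift_l1Basis _ _ _⟩
  choose Φ hΦn hΦ using hΦ
  obtain ⟨χ, -, hχ⟩ := exists_cochain (fun g => X.right (l1Basis (tupleProd g)) (T (Φ g)))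
    (C := ‖X.right‖ * (C * (‖X.left‖ * (‖X.right‖ * ‖ψ‖)))) (by positivity) fun g =>
      (hR _ _).trans (mul_le_mul_of_nonneg_left ((hT _).trans
        (mul_le_mul_of_nonneg_left (hΦn g) hC)) (ContinuousLinearMap.opNorm_nonneg _))
  replace hχ : ∀ g, χ (l1Tuple g) = X.right (l1Basis (tupleProd g)) (T (Φ g)) := hχ
  refine ⟨χ, cochain_ext fun g => ?_⟩
  change hochD X n χ (l1Tuple g) = ψ (l1Tuple g)
  let Φ' : BddMap ℓ¹(G, ℂ) E := ((X.left (l1Basis (g 0))).comp (X.right (l1Basis (g 0)⁻¹))).comp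
    ((Φ (Fin.tail g)).comp (ContinuousLinearMap.mul ℂ ℓ¹(G, ℂ) (l1Basis (g 0)⁻¹)))
  have hΦ'_apply : ∀ x, Φ' (l1Basis x) = X.left (l1Basis (g 0)) (X.right (l1Basis (g 0)⁻¹)
      (Φ (Fin.tail g) (l1Basis ((g 0)⁻¹ * x)))) := fun x => by
    rw [← l1Basis_mul_l1Basis]
    rfl
  have hTΦ' := hequiv (g 0) (Φ (Fin.tail g)) Φ' fun x => by
    rw [hΦ'_apply, inv_mul_cancel_left]
  -- the average of the cocycle identity over `x`
  have key : T (Φ' + ∑ j : Fin n, (-1 : ℂ) ^ ((j : ℕ) + 1) •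
        Φ (Fin.contractNth j.castSucc (· * ·) g) + (-1 : ℂ) ^ (n + 1) • Φ (Fin.init g)) =
      X.right (l1Basis (tupleProd g)⁻¹) (ψ (l1Tuple g)) := by
    refine hconst _ _ fun x => ?_
    have h1 : Φ' (l1Basis x) = X.left (l1Basis x) (X.right (l1Basis (tupleProd g)⁻¹)
        (ψ (l1Tuple (Fin.cons (x⁻¹ * g 0) (Fin.tail g))))) := by
      rw [hΦ'_apply, hΦ, X.right_left, hLL, hRR, mul_inv_cancel_left, tupleProd_succ g, mul_inv_rev,
        mul_inv_rev, inv_inv]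
    have h2 : ∀ j : Fin n, Φ (Fin.contractNth j.castSucc (· * ·) g) (l1Basis x) =
        X.left (l1Basis x) (X.right (l1Basis (tupleProd g)⁻¹)
          (ψ (l1Tuple (Fin.cons x⁻¹ (Fin.contractNth j.castSucc (· * ·) g))))) := fun j => by
      rw [hΦ, tupleProd_contractNth]
    have h3 : Φ (Fin.init g) (l1Basis x) = X.left (l1Basis x) (X.right (l1Basis (tupleProd g)⁻¹)
        (X.right (l1Basis (g (Fin.last n))) (ψ (l1Tuple (Fin.cons x⁻¹ (Fin.init g)))))) := by
      rw [hΦ, hRR, tupleProd_succ' g, mul_inv_rev, mul_inv_cancel_left]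
    have h4 := congrArg (fun φ => X.left (l1Basis x) (X.right (l1Basis (tupleProd g)⁻¹) φ))
      (cocycle_cons X ψ hψ x⁻¹ g)
    simp only [map_add, map_sum, map_smul] at h4
    rw [X.right_left, hLL, mul_inv_cancel, hl] at h4
    simp only [add_apply, sum_apply, smul_apply, h1, h2, h3]
    exact h4.symm
  simp only [map_add, map_sum, map_smul, hTΦ'] at key
  have key2 := congrArg (X.right (l1Basis (tupleProd g))) key
  rw [hRR, inv_mul_cancel, hr] at key2
  rw [← key2, hochD_l1Tuple]
  simp only [map_add, map_sum, map_smul, hχ, tupleProd_contractNth]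
  congr 1
  · congr 1
    rw [X.right_left, hRR, tupleProd_succ g, inv_mul_cancel_left]
  · rw [hRR, ← tupleProd_succ']

end Vanishing

/-! ### From bounded to simplicial cohomology -/

section Comparison

section Quotient

variable {A : Type*} [NormedRing A] [NormedAlgebra ℂ A]
  {M : Type*} [NormedAddCommGroup M] [NormedSpace ℂ M]
  {N : Type*} [NormedAddCommGroup N] [NormedSpace ℂ N]
  {X : BanachBimodule A M} {Y : BanachBimodule A N}

theorem continuous_mapQ_restrict {V W : Type*} [NormedAddCommGroup V] [NormedSpace ℂ V]
    [NormedAddCommGroup W] [NormedSpace ℂ W] {Z B : Submodule ℂ V} {Z' B' : Submodule ℂ W}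
    (f : V →ₗ[ℂ] W) (hf : Continuous f) (hZ : ∀ v ∈ Z, f v ∈ Z')
    (hB : B.submoduleOf Z ≤ (B'.submoduleOf Z').comap (f.restrict hZ)) :
    Continuous (Submodule.mapQ (B.submoduleOf Z) (B'.submoduleOf Z') (f.restrict hZ) hB) := by
  refine (Submodule.isQuotientMap_mkQ _).continuous_iff.2 ?_
  exact (Submodule.isQuotientMap_mkQ (B'.submoduleOf Z')).continuous.comp
    ((hf.comp continuous_subtype_val).subtype_mk fun z => hZ z z.2)

/-- A map of bimodules induces a topological isomorphism in degree `n` if on cochains it has a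
bounded left inverse `σ` which preserves cocycles and coboundaries and which is, on cocycles, a
right inverse up to coboundaries. -/
theorem exists_hochCohomology_equiv (f : X.Hom Y) (n : ℕ)
    (σ : HochCochain A N n →ₗ[ℂ] HochCochain A M n) (hσ : Continuous σ)
    (hσZ : ∀ ψ ∈ hochCocycles Y n, σ ψ ∈ hochCocycles X n)
    (hσB : ∀ ψ ∈ hochCoboundaries Y n, σ ψ ∈ hochCoboundaries X n)
    (hσf : ∀ ψ, σ (hochCochainMap f n ψ) = ψ)
    (hfσ : ∀ ψ ∈ hochCocycles Y n, ψ - hochCochainMap f n (σ ψ) ∈ hochCoboundaries Y n) :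
    ∃ e : HochCohomology X n ≃L[ℂ] HochCohomology Y n, ∀ c, e c = hochCohomologyMap f n c := by
  let τ : HochCohomology Y n →ₗ[ℂ] HochCohomology X n :=
    Submodule.mapQ _ _ (σ.restrict hσZ) fun ψ hψ => hσB ψ hψ
  have h1 : ∀ c, τ (hochCohomologyMap f n c) = c := fun c => by
    obtain ⟨ψ, rfl⟩ := Submodule.Quotient.mk_surjective _ c
    exact congrArg (Submodule.Quotient.mk (p := (hochCoboundaries X n).submoduleOf _))
      (Subtype.ext (hσf ψ))
  have h2 : ∀ c, hochCohomologyMap f n (τ c) = c := fun c => by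
    obtain ⟨ψ, rfl⟩ := Submodule.Quotient.mk_surjective _ c
    symm
    exact (Submodule.Quotient.eq _).2 (hfσ ψ ψ.2)
  exact ⟨{ hochCohomologyMap f n with
      invFun := τ
      left_inv := h1
      right_inv := h2
      continuous_toFun := continuous_mapQ_restrict (hochCochainMap f n)
        (ContinuousLinearMap.continuous (ContinuousLinearMap.compContinuousMultilinearMapL ℂ
          (fun _ : Fin n => A) M N f.toCLM)) _ _
      continuous_invFun := continuous_mapQ_restrict σ hσ _ _ }, fun c => rfl⟩

/-- If a map of bimodules `f : X → Y` is the kernel of a map `r : Y → Z` for which cochains lift, if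
`f` has a bounded left inverse on cochains (a chain map, not necessarily induced by a map
of bimodules), and if the cohomology of `Z` vanishes, then `f` induces a topological
isomorphism in cohomology. -/
theorem exists_hochCohomology_equiv_of_retraction {P : Type*} [NormedAddCommGroup P]
    [NormedSpace ℂ P] {Z : BanachBimodule A P} (f : X.Hom Y) (r : Y.Hom Z)
    (σ : ∀ n, HochCochain A N n →ₗ[ℂ] HochCochain A M n) (hσ : ∀ n, Continuous (σ n))
    (hσd : ∀ n ψ, σ (n + 1) (hochD Y n ψ) = hochD X n (σ n ψ))
    (hσf : ∀ n ψ, σ n (hochCochainMap f n ψ) = ψ)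
    (hker : ∀ n ψ, hochCochainMap r n ψ = 0 → ∃ θ, hochCochainMap f n θ = ψ)
    (hlift : ∀ n χ, ∃ ψ, hochCochainMap r n ψ = χ) (n : ℕ)
    (hZ : ∀ ψ, hochD Z (n + 1) ψ = 0 → ∃ χ, hochD Z n χ = ψ) :
    ∃ e : HochCohomology X (n + 1) ≃L[ℂ] HochCohomology Y (n + 1),
      ∀ c, e c = hochCohomologyMap f (n + 1) c := by
  refine exists_hochCohomology_equiv f (n + 1) (σ (n + 1)) (hσ _) ?_ ?_ (hσf _) ?_
  · intro ψ hψ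
    refine LinearMap.mem_ker.2 ?_
    rw [← hσd, LinearMap.mem_ker.1 hψ, map_zero]
  · rintro _ ⟨χ, rfl⟩
    exact ⟨σ n χ, (hσd n χ).symm⟩
  · intro ψ hψ
    obtain ⟨χ, hχ⟩ := hZ (hochCochainMap r _ ψ) (hochCochainMap_mem_cocycles r _ ψ hψ)
    obtain ⟨χ', rfl⟩ := hlift n χ
    -- `ψ - dχ'` is killed by `r`, so it is in the range of `f` and is fixed by the projection `f σ`;
    -- this says that `ψ - f σ ψ = d(χ' - f σ χ')`
    obtain ⟨θ, hθ⟩ := hker (n + 1) (ψ - hochD Y n χ') (by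
      rw [map_sub, ← hχ, hochD_hochCochainMap, sub_self])
    have h1 : hochCochainMap f _ (σ (n + 1) (ψ - hochD Y n χ')) = ψ - hochD Y n χ' := by
      rw [← hθ, hσf]
    rw [map_sub, map_sub, hσd, ← hochD_hochCochainMap, sub_eq_sub_iff_add_eq_add] at h1
    refine ⟨χ' - hochCochainMap f n (σ n χ'), ?_⟩
    rw [map_sub, sub_eq_sub_iff_add_eq_add]
    exact (add_comm _ _).trans h1

end Quotient

variable {G : Type*} [Group G]

/-- The bounded left inverse of the canonical map on cochains: the twist
`(g₁, …, gₙ) ↦ ψ(g₁, …, gₙ)((g₁ ⋯ gₙ)⁻¹)`. Under the identification of Hochschild cochains with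
group cochains for the conjugation action, it is evaluation at the central vector `δ_1`. -/
theorem exists_twist (n : ℕ) :
    ∃ σ : HochCochain ℓ¹(G, ℂ) (BddMap ℓ¹(G, ℂ) ℂ) n →ₗ[ℂ] HochCochain ℓ¹(G, ℂ) ℂ n,
      Continuous σ ∧ ∀ ψ g, σ ψ (l1Tuple g) = ψ (l1Tuple g) (l1Basis (tupleProd g)⁻¹) := by
  have h : ∀ ψ : HochCochain ℓ¹(G, ℂ) (BddMap ℓ¹(G, ℂ) ℂ) n, ∃ χ : HochCochain ℓ¹(G, ℂ) ℂ n,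
      ‖χ‖ ≤ ‖ψ‖ ∧ ∀ g, χ (l1Tuple g) = ψ (l1Tuple g) (l1Basis (tupleProd g)⁻¹) := fun ψ =>
    exists_cochain (fun g => ψ (l1Tuple g) (l1Basis (tupleProd g)⁻¹)) (norm_nonneg ψ) fun g => by
      refine ((ψ (l1Tuple g)).le_opNorm _).trans ?_
      simpa [norm_l1Basis] using norm_apply_l1Tuple_le ψ g
  choose σ hσn hσ using h
  let τ : HochCochain ℓ¹(G, ℂ) (BddMap ℓ¹(G, ℂ) ℂ) n →ₗ[ℂ] HochCochain ℓ¹(G, ℂ) ℂ n :=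
    { toFun := σ
      map_add' := fun ψ χ => cochain_ext fun g => by
        change σ (ψ + χ) (l1Tuple g) = σ ψ (l1Tuple g) + σ χ (l1Tuple g)
        rw [hσ, hσ, hσ]
        rfl
      map_smul' := fun c ψ => cochain_ext fun g => by
        change σ (c • ψ) (l1Tuple g) = c • σ ψ (l1Tuple g)
        rw [hσ, hσ]
        rfl }
  refine ⟨τ, ?_, hσ⟩
  exact (τ.mkContinuous 1 fun ψ => by rw [one_mul]; exact hσn ψ).continuous

/-- The transpose of a bounded operator. -/
def BddMap.transpose {V W : Type*} [NormedAddCommGroup V] [NormedSpace ℂ V] [NormedAddCommGroup W]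
    [NormedSpace ℂ W] (i : BddMap V W) : BddMap (BddMap W ℂ) (BddMap V ℂ) :=
  (ContinuousLinearMap.compL ℂ V W ℂ).flip i

variable (G) in
/-- The map of bimodules `ℓ¹(G)' → I₀(G)'` given by restriction. -/
def dualRestrict : (BanachBimodule.regular ℓ¹(G, ℂ)).dual.Hom (augIdealBimodule G).dual where
  toCLM := BddMap.transpose (augIdeal G).subtypeL
  map_left _ _ := rfl
  map_right _ _ := rfl

theorem augIdeal_dual_left_one (φ : BddMap (augIdeal G) ℂ) :
    (augIdealBimodule G).dual.left (l1Basis 1) φ = φ := by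
  ext f
  rw [BanachBimodule.dual_left_apply]
  congr 1
  ext1
  exact mul_one (f : ℓ¹(G, ℂ))

theorem augIdeal_dual_right_one (φ : BddMap (augIdeal G) ℂ) :
    (augIdealBimodule G).dual.right (l1Basis 1) φ = φ := by
  ext f
  rw [BanachBimodule.dual_right_apply]
  congr 1
  ext1
  exact one_mul (f : ℓ¹(G, ℂ))

/-- Every cocycle of positive degree with values in `I₀(G)'` is a coboundary. -/
theorem exists_hochD_eq_augIdeal_dual (hG : IsCommutativeTransitive G) (n : ℕ)
    (ψ : HochCochain ℓ¹(G, ℂ) (BddMap (augIdeal G) ℂ) (n + 1))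
    (hψ : hochD (augIdealBimodule G).dual (n + 1) ψ = 0) :
    ∃ χ : HochCochain ℓ¹(G, ℂ) (BddMap (augIdeal G) ℂ) n,
      hochD (augIdealBimodule G).dual n χ = ψ :=
  (exists_average hG).elim fun T hT =>
    exists_hochD_eq_of_average (augIdealBimodule G).dual augIdeal_dual_left_one
      augIdeal_dual_right_one T 2 zero_le_two hT.1 hT.2.1 hT.2.2 n ψ hψ

/-- The twist is a cochain map. -/
theorem twist_hochD {n : ℕ}
    {σ : HochCochain ℓ¹(G, ℂ) (BddMap ℓ¹(G, ℂ) ℂ) n → HochCochain ℓ¹(G, ℂ) ℂ n}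
    (hσ : ∀ ψ g, σ ψ (l1Tuple g) = ψ (l1Tuple g) (l1Basis (tupleProd g)⁻¹))
    {σ' : HochCochain ℓ¹(G, ℂ) (BddMap ℓ¹(G, ℂ) ℂ) (n + 1) → HochCochain ℓ¹(G, ℂ) ℂ (n + 1)}
    (hσ' : ∀ ψ g, σ' ψ (l1Tuple g) = ψ (l1Tuple g) (l1Basis (tupleProd g)⁻¹))
    (ψ : HochCochain ℓ¹(G, ℂ) (BddMap ℓ¹(G, ℂ) ℂ) n) :
    σ' (hochD (BanachBimodule.regular ℓ¹(G, ℂ)).dual n ψ) = hochD (augBimodule G) n (σ ψ) := by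
  refine cochain_ext fun g => ?_
  change σ' _ (l1Tuple g) = hochD (augBimodule G) n (σ ψ) (l1Tuple g)
  have haug : ∀ (x : G) (z : ℂ), augmentation G (l1Basis x) * z = z := fun x z => by
    rw [augmentation_l1Basis, one_mul]
  rw [hσ', hochD_l1Tuple, hochD_l1Tuple]
  simp only [hσ, tupleProd_contractNth, add_apply, sum_apply, smul_apply,
    BanachBimodule.dual_left_apply, BanachBimodule.dual_right_apply]
  congr 1
  · congr 1
    refine Eq.trans ?_ (haug (g 0) _).symm
    change ψ _ (l1Basis (tupleProd g)⁻¹ * l1Basis (g 0)) = _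
    rw [l1Basis_mul_l1Basis, tupleProd_succ g, mul_inv_rev, inv_mul_cancel_right]
  · congr 1
    refine Eq.trans ?_ (haug (g (Fin.last n)) _).symm
    change ψ _ (l1Basis (g (Fin.last n)) * l1Basis (tupleProd g)⁻¹) = _
    rw [l1Basis_mul_l1Basis, tupleProd_succ' g, mul_inv_rev, mul_inv_cancel_left]

variable (G) in
/-- The map of bimodules `ℂ_ε → ℓ¹(G)'` which sends `1` to `ε`. -/
abbrev augToDual : (augBimodule G).Hom (BanachBimodule.regular ℓ¹(G, ℂ)).dual :=
  BanachBimodule.charToDual (augmentation G) augmentation_mul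

/-- A cochain with values in `ℓ¹(G)'` which vanishes on the augmentation ideal takes its values in
the multiples of `ε`. -/
theorem exists_eq_augToDual {n : ℕ} (ψ : HochCochain ℓ¹(G, ℂ) (BddMap ℓ¹(G, ℂ) ℂ) n)
    (hψ : hochCochainMap (dualRestrict G) n ψ = 0) :
    ∃ θ : HochCochain ℓ¹(G, ℂ) ℂ n, hochCochainMap (augToDual G) n θ = ψ := by
  refine ⟨(ContinuousLinearMap.apply ℂ ℂ (l1Basis 1)).compContinuousMultilinearMap ψ, ?_⟩
  ext1 a
  refine l1_ext fun s => ?_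
  have h1 : ψ a (l1Basis s - l1Basis 1) = 0 :=
    DFunLike.congr_fun (DFunLike.congr_fun hψ a) (augElt s)
  rw [map_sub, sub_eq_zero] at h1
  change ψ a (l1Basis 1) • augmentation G (l1Basis s) = _
  rw [augmentation_l1Basis, smul_eq_mul, mul_one, h1]

/-- Cochains with values in `I₀(G)'` lift to cochains with values in `ℓ¹(G)'`, since `I₀(G)` is
complemented. -/
theorem exists_dualRestrict_eq {n : ℕ} (χ : HochCochain ℓ¹(G, ℂ) (BddMap (augIdeal G) ℂ) n) :
    ∃ ψ : HochCochain ℓ¹(G, ℂ) (BddMap ℓ¹(G, ℂ) ℂ) n,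
      hochCochainMap (dualRestrict G) n ψ = χ := by
  refine ⟨(BddMap.transpose (augProj G)).compContinuousMultilinearMap χ, ?_⟩
  ext a f
  exact congrArg (χ a) (augProj_coe f)

theorem exists_boundedToSimplicial_equiv (hG : IsCommutativeTransitive G) (n : ℕ) :
    ∃ e : BoundedCohomology G (n + 1) ≃L[ℂ] SimplicialCohomology G (n + 1),
      ∀ c, e c = boundedToSimplicial G (n + 1) c := by
  have hs := fun n => exists_twist (G := G) n
  choose σ hσc hσ using hs
  refine exists_hochCohomology_equiv_of_retraction (augToDual G) (dualRestrict G) σ hσc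
    (fun n ψ => twist_hochD (hσ n) (hσ (n + 1)) ψ) (fun n θ => ?_)
    (fun _ => exists_eq_augToDual) (fun _ => exists_dualRestrict_eq) n
    (exists_hochD_eq_augIdeal_dual hG n)
  refine cochain_ext fun g => ?_
  refine (hσ n _ g).trans ?_
  change θ (l1Tuple g) • augmentation G _ = θ (l1Tuple g)
  rw [augmentation_l1Basis, smul_eq_mul, mul_one]

end Comparison

end

theorem mainTheorem1 (G : Type*) [Group G] (hG : IsCommutativeTransitive G) :
    (∀ n : ℕ, 1 ≤ n → Subsingleton (HochCohomology (augIdealBimodule G).dual n)) ∧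
    (∀ n : ℕ, 1 ≤ n → ∃ e : BoundedCohomology G n ≃L[ℂ] SimplicialCohomology G n,
      ∀ c, e c = boundedToSimplicial G n c) := by
  refine ⟨fun n hn => ?_, fun n hn => ?_⟩
  · obtain ⟨n, rfl⟩ := Nat.exists_eq_add_of_le' hn
    refine Submodule.Quotient.subsingleton_iff.2 (eq_top_iff.2 fun ψ _ => ?_)
    exact exists_hochD_eq_augIdeal_dual hG n ψ ψ.2
  · obtain ⟨n, rfl⟩ := Nat.exists_eq_add_of_le' hn
    exact exists_boundedToSimplicial_equiv hG n
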